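/- **Model.** Fix constants $\lambda_{\rm U},R_{\rm B},\alpha_{\rm L},G_{\rm A},g_{\rm A},G_{\rm U},g_{\rm U},B,\rho_0>0$ and $\theta_{\rm A},\theta_{\rm U}\in(0,2\pi]$. For a relative density $\psi>0$ and a spatial multiplexing gain $k\ge 1$ with $k\theta_{\rm A}\le 2\pi$, the access points form a homogeneous Poisson point process $\Phi_{\rm A}$ in $\mathbb R^2$ of intensity $\lambda_{\rm A}=\psi/(\pi R_{\rm B}^2)$. Each $x\in\Phi_{\rm A}$ carries two gains $\mathbb G_{{\rm A},x},\mathbb G_{{\rm U},x}$, where all the gains are independent of each other and of $\Phi_{\rm A}$, $\mathbb P(\mathbb G_{{\rm A},x}=G_{\rm A})=\frac{k\theta_{\rm A}}{2\pi}=1-\mathbb P(\mathbb G_{{\rm A},x}=g_{\rm A})$ and $\mathbb P(\mathbb G_{{\rm U},x}=G_{\rm U})=\frac{\theta_{\rm U}}{2\pi}=1-\mathbb P(\mathbb G_{{\rm U},x}=g_{\rm U})$ (if the two values coincide, the gain is that constant). Let $\ell(r)^{-1}=r^{-\alpha_{\rm L}}$ for $r\le R_{\rm B}$ and $\ell(r)^{-1}=0$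 for $r>R_{\rm B}$. The end-user at the origin is served by $x_0=\arg\max_{x\in\Phi_{\rm A}}\ell(|x|)^{-1}$, and $$\mathrm{SINR}=\frac{G_{\rm A}G_{\rm U}\,\ell(|x_0|)^{-1}}{\sum_{x\in\Phi_{\rm A}\setminus\{x_0\}}\mathbb G_{{\rm A},x}\mathbb G_{{\rm U},x}\,\ell(|x|)^{-1}},\qquad \mathcal C_\psi(\tau,k)=\mathbb P(\mathrm{SINR}>\tau),$$ where $\mathrm{SINR}=+\infty$ if the numerator is positive and the denominator vanishes, and $\mathrm{SINR}=0$ if the numerator vanishes. **Load.** The bandwidth of the end-user at the origin is $B/\Psi$, where $\Psi\ge1$ is integer-valued and independent of the SINR, with either of the following two laws: (i) given $\mathcal A'$, $\Psi-1$ is Poisson with mean $\lambda_{\rm U}\mathcal A'$, where $\mathcal A'$ has density proportional to $y^{3.5}e^{-3.5k\lambda_{\rm A}y}$ on $0<y\le\pi R_{\rm B}^2/k$; (ii) the simplified law $$\mathbb P(\Psi=n)=\frac{3.5^{3.5}\,\Gamma(n+3.5)}{(n-1)!\,\Gamma(3.5)}\Big(\frac{\pi R_{\rm B}^2\lambda_{\rm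 U}}{k\psi}\Big)^{n-1}\Big(3.5+\frac{\pi R_{\rm B}^2\lambda_{\rm U}}{k\psi}\Big)^{-n-3.5},\qquad n\ge1.$$ **Throughput and densification gain.** The throughput of the fixed-rate coding scheme with rate threshold $\rho$ is $$\mathcal T(\rho;\psi,k)=\lambda_{\rm U}\,\rho\,\mathbb P\Big(\tfrac B\Psi\log_2(1+\mathrm{SINR})>\rho\Big)=\lambda_{\rm U}\,\rho\,\mathbb E_\Psi\big[\mathcal C_\psi(2^{\rho\Psi/B}-1,k)\big],$$ and the densification gain is $\gamma(\psi,k)=\mathcal T(\psi\rho_0;\psi,k)/\mathcal T(\rho_0;1,k)$. **Lemma.** For $k=1$ and for each of the two laws of $\Psi$, $\mathcal T(\rho_0;1,1)>0$, and the densification gain is bounded by a finite constant as $\psi\to\infty$: there is a constant $a<\infty$ such that $\gamma(\psi,1)\le a$ for all sufficiently large $\psi$. -/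

import Mathlib

open MeasureTheory ProbabilityTheory Filter
open scoped ENNReal Nat

noncomputable section

namespace MmWave

/-- The Euclidean plane. -/
abbrev Plane : Type := EuclideanSpace ℝ (Fin 2)

/-- The number (with multiplicity) of points of the sequence `X` that lie in `s`. -/
def pointCount {Ω E : Type*} (X : ℕ → Ω → E) (s : Set E) (ω : Ω) : ℕ∞ :=
  {i : ℕ | X i ω ∈ s}.encard

/-- The random points `X 0, X 1, …` enumerate a Poisson point process with intensity measure `ν`
(of infinite total mass): counts are Poisson, and counts in disjoint sets are independent. -/
structure IsPoissonPointProcess {Ω E : Type*} [MeasurableSpace Ω] [MeasurableSpace E]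
    (P : Measure Ω) (X : ℕ → Ω → E) (ν : Measure E) : Prop where
  measurable : ∀ i, Measurable (X i)
  poisson : ∀ s : Set E, MeasurableSet s → ν s ≠ ∞ → ∀ n : ℕ,
    P {ω | pointCount X s ω = n} = poissonMeasure (ν s).toNNReal {n}
  indep : ∀ (m : ℕ) (s : Fin m → Set E), (∀ j, MeasurableSet (s j)) →
    Pairwise (fun i j => Disjoint (s i) (s j)) → iIndepFun (fun j => pointCount X (s j)) P

/-- The constant system parameters of the network. -/
structure Params where
  /-- intensity of the end-users -/
  lamU : ℝ
  /-- radius of the line-of-sight ball -/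
  RB : ℝ
  /-- line-of-sight path loss exponent -/
  alpha : ℝ
  /-- main lobe gain of an access point -/
  mainA : ℝ
  /-- side lobe gain of an access point -/
  sideA : ℝ
  /-- main lobe gain of an end-user -/
  mainU : ℝ
  /-- side lobe gain of an end-user -/
  sideU : ℝ
  /-- main lobe width of an access point -/
  thetaA : ℝ
  /-- main lobe width of an end-user -/
  thetaU : ℝ
  /-- total bandwidth available at an access point -/
  B : ℝ
  lamU_pos : 0 < lamU
  RB_pos : 0 < RB
  alpha_pos : 0 < alpha
  mainA_pos : 0 < mainA
  sideA_pos : 0 < sideA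
  mainU_pos : 0 < mainU
  sideU_pos : 0 < sideU
  thetaA_pos : 0 < thetaA
  thetaA_le : thetaA ≤ 2 * Real.pi
  thetaU_pos : 0 < thetaU
  thetaU_le : thetaU ≤ 2 * Real.pi
  B_pos : 0 < B

/-- The intensity `λ_A` of the access points at relative density `ψ`, i.e. `ψ = π λ_A R_B ^ 2`. -/
def Params.lamA (net : Params) (ψ : ℝ) : ℝ := ψ / (Real.pi * net.RB ^ 2)

/-- The inverse path loss `ℓ(r)⁻¹` of the line-of-sight ball model. -/
def Params.invPathLoss (net : Params) (r : ℝ) : ℝ :=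
  if r ≤ net.RB then r ^ (-net.alpha) else 0

/-- The law that gives mass `p` to `a` and mass `1 - p` to `b`. -/
def twoPointLaw (p a b : ℝ) : Measure ℝ :=
  ENNReal.ofReal p • Measure.dirac a + ENNReal.ofReal (1 - p) • Measure.dirac b

/-- The positions of the access points, as seen from the typical end-user at the origin, with the
hybrid precoding gains of the (unintended) link from each access point to that end-user. -/
structure Deployment (Ω : Type*) where
  pos : ℕ → Ω → Plane
  gainA : ℕ → Ω → ℝ
  gainU : ℕ → Ω → ℝ

/-- The deployment has relative density `ψ` and spatial multiplexing gain `k`: the access points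
form a homogeneous Poisson point process of intensity `λ_A`, independently marked with independent
two-valued gains. -/
structure Deployment.IsNetwork {Ω : Type*} [MeasurableSpace Ω] (N : Deployment Ω)
    (net : Params) (ψ : ℝ) (k : ℕ) (P : Measure Ω) : Prop where
  poisson : IsPoissonPointProcess P N.pos (ENNReal.ofReal (net.lamA ψ) • (volume : Measure Plane))
  measurable_gainA : ∀ i, Measurable (N.gainA i)
  measurable_gainU : ∀ i, Measurable (N.gainU i)
  law_gainA : ∀ i, P.map (N.gainA i) =
    twoPointLaw (k * net.thetaA / (2 * Real.pi)) net.mainA net.sideA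
  law_gainU : ∀ i, P.map (N.gainU i) =
    twoPointLaw (net.thetaU / (2 * Real.pi)) net.mainU net.sideU
  indep_gains : ∀ i, IndepFun (N.gainA i) (N.gainU i) P
  iIndep_marks : iIndepFun (fun i ω => (N.gainA i ω, N.gainU i ω)) P
  indep_pos_marks : IndepFun (fun ω i => N.pos i ω) (fun ω i => (N.gainA i ω, N.gainU i ω)) P

/-- The index of the access point `x₀` that serves the origin: an index maximizing
`ℓ(|x|)⁻¹` (the least one; almost surely a maximizer exists). -/
def Deployment.server {Ω : Type*} (N : Deployment Ω) (net : Params) (ω : Ω) : ℕ :=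
  sInf {i : ℕ | ∀ j, net.invPathLoss ‖N.pos j ω‖ ≤ net.invPathLoss ‖N.pos i ω‖}

/-- The received power from the aligned serving access point. -/
def Deployment.signal {Ω : Type*} (N : Deployment Ω) (net : Params) (ω : Ω) : ℝ≥0∞ :=
  ENNReal.ofReal (net.mainA * net.mainU * net.invPathLoss ‖N.pos (N.server net ω) ω‖)

/-- The received power from all the other access points. -/
def Deployment.interference {Ω : Type*} (N : Deployment Ω) (net : Params) (ω : Ω) : ℝ≥0∞ :=
  ∑' i : ℕ, if i = N.server net ω then 0 else
    ENNReal.ofReal (N.gainA i ω * N.gainU i ω * net.invPathLoss ‖N.pos i ω‖)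

/-- The SINR at the origin, thermal noise being ignored. It is `∞` if there is a signal and no
interference, and `0` if there is no signal. -/
def Deployment.sinr {Ω : Type*} (N : Deployment Ω) (net : Params) (ω : Ω) : ℝ≥0∞ :=
  N.signal net ω / N.interference net ω

/-- The coverage probability `𝒞_ψ(τ, k) = ℙ(SINR > τ)`. -/
def Deployment.coverage {Ω : Type*} [MeasurableSpace Ω] (N : Deployment Ω) (net : Params)
    (P : Measure Ω) (τ : ℝ) : ℝ :=
  P.real {ω | ENNReal.ofReal τ < N.sinr net ω}

/-- The unnormalized density of the area of the sector that contains the typical end-user,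
on `0 < y ≤ π R_B ^ 2 / k`. -/
def Params.areaDensity (net : Params) (ψ : ℝ) (k : ℕ) (y : ℝ) : ℝ :=
  y ^ (3.5 : ℝ) * Real.exp (-3.5 * k * net.lamA ψ * y)

/-- `ℙ(Ψ = n)` for the number `Ψ` of end-users that share the resources with the one at the origin:
given the sector area `y`, `Ψ - 1` is Poisson with mean `λ_U y`. -/
def loadPMF (net : Params) (ψ : ℝ) (k n : ℕ) : ℝ :=
  if n = 0 then 0 else
    (∫ y in (0 : ℝ)..(Real.pi * net.RB ^ 2 / k),
        Real.exp (-(net.lamU * y)) * (net.lamU * y) ^ (n - 1) / ((n - 1)! : ℝ) *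
          net.areaDensity ψ k y) /
      ∫ y in (0 : ℝ)..(Real.pi * net.RB ^ 2 / k), net.areaDensity ψ k y

/-- The simplified form of `ℙ(Ψ = n)`, in which the sector area is not truncated. -/
def simplifiedLoadPMF (net : Params) (ψ : ℝ) (k n : ℕ) : ℝ :=
  if n = 0 then 0 else
    (3.5 : ℝ) ^ (3.5 : ℝ) * Real.Gamma (n + 3.5) / (((n - 1)! : ℝ) * Real.Gamma 3.5) *
      (Real.pi * net.RB ^ 2 * net.lamU / (k * ψ)) ^ (n - 1) *
      (3.5 + Real.pi * net.RB ^ 2 * net.lamU / (k * ψ)) ^ (-(n : ℝ) - 3.5)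

/-- The throughput `λ_U ρ 𝔼_Ψ[𝒞_ψ(2 ^ (ρ Ψ / B) - 1, k)]` of the fixed-rate coding scheme with rate
threshold `ρ`, where `load n = ℙ(Ψ = n)`. -/
def Deployment.throughput {Ω : Type*} [MeasurableSpace Ω] (N : Deployment Ω) (net : Params)
    (P : Measure Ω) (load : ℕ → ℝ) (ρ : ℝ) : ℝ :=
  net.lamU * ρ * ∑' n : ℕ, load n * N.coverage net P ((2 : ℝ) ^ (ρ * n / net.B) - 1)

/-- The densification gain `γ(ψ, k) = 𝒯(ψ ρ₀; ψ, k) / 𝒯(ρ₀; 1, k)`, where `N ψ` is the network of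
relative density `ψ` and `load ψ k` is the law of `Ψ`. -/
def densificationGain {Ω : ℝ → Type*} [∀ ψ, MeasurableSpace (Ω ψ)] (net : Params)
    (P : ∀ ψ, Measure (Ω ψ)) (N : ∀ ψ, Deployment (Ω ψ)) (load : ℝ → ℕ → ℕ → ℝ)
    (ρ₀ ψ : ℝ) (k : ℕ) : ℝ :=
  (N ψ).throughput net (P ψ) (load ψ k) (ψ * ρ₀) / (N 1).throughput net (P 1) (load 1 k) ρ₀

end MmWave

end

/-!
Interference is bounded below by a positive constant as soon as a second access point lies in the
line-of-sight ball. Hence the SINR can exceed a threshold `τ` only if at most one access point lies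
in the ball, which has probability `(1 + ψ) e ^ (-ψ)`, or if some access point lies within a
distance of order `τ ^ (-1 / α)`, which has probability at most of order `ψ τ ^ (-2 / α)`. Since
`Ψ ≥ 1`, at rate `ψ ρ₀` the threshold is at least `2 ^ (ψ ρ₀ / B) - 1`, so the coverage probability
is `o(1 / ψ)` and the densification gain even tends to zero. Only the total mass of the load law
matters here. Both laws are mixtures of Poisson laws over a density, hence have mass one.
-/

namespace MmWave

section PointProcess

variable {Ω E : Type*} [MeasurableSpace Ω] [MeasurableSpace E] {P : Measure Ω} {X : ℕ → Ω → E}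
  {ν : Measure E} {s : Set E}

theorem measurable_pointCount (hX : ∀ i, Measurable (X i)) (hs : MeasurableSet s) :
    Measurable (pointCount X s) :=
  measurable_encard.comp (measurable_set_iff.2 fun i => measurable_mem.2 (hX i hs))

namespace IsPoissonPointProcess

theorem measureReal_pointCount_eq (h : IsPoissonPointProcess P X ν) (hs : MeasurableSet s)
    (hν : ν s ≠ ∞) (n : ℕ) :
    P.real {ω | pointCount X s ω = n} = Real.exp (-ν.real s) * ν.real s ^ n / n ! := by
  rw [measureReal_def, h.poisson s hs hν, ← measureReal_def, poissonMeasure_real_singleton]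
  rfl

theorem measureReal_pointCount_ne_zero [IsProbabilityMeasure P] (h : IsPoissonPointProcess P X ν)
    (hs : MeasurableSet s) (hν : ν s ≠ ∞) :
    P.real {ω | pointCount X s ω ≠ 0} = 1 - Real.exp (-ν.real s) := by
  have hzero : P.real {ω | pointCount X s ω = 0} = Real.exp (-ν.real s) := by
    simpa using h.measureReal_pointCount_eq hs hν 0
  rw [← hzero]
  exact probReal_compl_eq_one_sub
    (measurable_pointCount h.measurable hs (measurableSet_singleton 0))

theorem measureReal_pointCount_le_one [IsFiniteMeasure P] (h : IsPoissonPointProcess P X ν)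
    (hs : MeasurableSet s) (hν : ν s ≠ ∞) :
    P.real {ω | pointCount X s ω ≤ 1} = (1 + ν.real s) * Real.exp (-ν.real s) := by
  have hunion : {ω | pointCount X s ω ≤ 1} =
      {ω | pointCount X s ω = (0 : ℕ)} ∪ {ω | pointCount X s ω = (1 : ℕ)} := by
    ext ω
    simp [Order.le_one_iff]
  have hdisj : Disjoint {ω | pointCount X s ω = (0 : ℕ)} {ω | pointCount X s ω = (1 : ℕ)} :=
    Set.disjoint_left.2 fun ω h0 h1 => by simp_all
  rw [hunion, measureReal_union hdisj
    (measurable_pointCount h.measurable hs (measurableSet_singleton _)),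
    h.measureReal_pointCount_eq hs hν, h.measureReal_pointCount_eq hs hν]
  simp only [pow_zero, pow_one, Nat.factorial_zero, Nat.factorial_one, Nat.cast_one, div_one]
  ring

end IsPoissonPointProcess

end PointProcess

theorem ae_min_le_of_map_eq_twoPointLaw {Ω : Type*} [MeasurableSpace Ω] {P : Measure Ω}
    {X : Ω → ℝ} (hX : AEMeasurable X P) {p a b : ℝ} (h : P.map X = twoPointLaw p a b) :
    ∀ᵐ ω ∂P, min a b ≤ X ω := by
  refine ae_of_ae_map (p := fun x => min a b ≤ x) hX ?_
  rw [h, twoPointLaw, ae_add_measure_iff]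
  constructor <;> refine Measure.ae_smul_measure ?_ _ <;> simp [ae_dirac_eq]

namespace Params

variable (net : Params)

/-- The points of the plane from which a positive power is received at the origin. The origin is
excluded because `0 ^ (-α)` takes the junk value `0`. -/
def visible : Set Plane := Metric.closedBall 0 net.RB \ {0}

/-- The least power that can be received at the origin from a visible access point other than the
server, namely over both side lobes or both main lobes at distance `R_B`, whichever are weaker. -/
noncomputable def minInterference : ℝ :=
  min net.mainA net.sideA * min net.mainU net.sideU * net.RB ^ (-net.alpha)

/-- The distance at which the aligned serving access point achieves an SINR of `τ` against an
interference of `minInterference`. -/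
noncomputable def coverageRadius (τ : ℝ) : ℝ :=
  (τ * net.minInterference / (net.mainA * net.mainU)) ^ (-net.alpha)⁻¹

/-- The intensity measure of the access points at relative density `ψ`. -/
noncomputable abbrev intensity (ψ : ℝ) : Measure Plane := ENNReal.ofReal (net.lamA ψ) • volume

variable {net}

theorem invPathLoss_of_notMem_visible {x : Plane} (hx : x ∉ net.visible) :
    net.invPathLoss ‖x‖ = 0 := by
  rw [invPathLoss, ite_eq_right_iff]
  intro hle
  have hzero : x = 0 := by simpa [visible, hle] using hx
  simp [hzero, Real.zero_rpow (neg_ne_zero.2 net.alpha_pos.ne')]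

theorem invPathLoss_of_mem_visible {x : Plane} (hx : x ∈ net.visible) :
    net.invPathLoss ‖x‖ = ‖x‖ ^ (-net.alpha) :=
  if_pos (mem_closedBall_zero_iff.1 hx.1)

theorem norm_pos_of_mem_visible {x : Plane} (hx : x ∈ net.visible) : 0 < ‖x‖ :=
  norm_pos_iff.2 hx.2

theorem invPathLoss_pos_of_mem_visible {x : Plane} (hx : x ∈ net.visible) :
    0 < net.invPathLoss ‖x‖ := by
  rw [invPathLoss_of_mem_visible hx]
  exact Real.rpow_pos_of_pos (norm_pos_of_mem_visible hx) _

theorem rpow_neg_alpha_le_invPathLoss_of_mem_visible {x : Plane} (hx : x ∈ net.visible) :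
    net.RB ^ (-net.alpha) ≤ net.invPathLoss ‖x‖ := by
  rw [invPathLoss_of_mem_visible hx]
  exact Real.rpow_le_rpow_of_nonpos (norm_pos_of_mem_visible hx) (mem_closedBall_zero_iff.1 hx.1)
    (neg_nonpos.2 net.alpha_pos.le)

theorem norm_lt_rpow_of_lt_invPathLoss {x : Plane} {m : ℝ} (hm : 0 < m)
    (h : m < net.invPathLoss ‖x‖) : ‖x‖ < m ^ (-net.alpha)⁻¹ := by
  have hx : x ∈ net.visible := by
    by_contra hx
    exact (hm.trans h).ne' (invPathLoss_of_notMem_visible hx)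
  rw [invPathLoss_of_mem_visible hx] at h
  exact (Real.lt_rpow_inv_iff_of_neg (norm_pos_of_mem_visible hx) hm
    (neg_lt_zero.2 net.alpha_pos)).2 h

variable (net)

theorem minInterference_pos : 0 < net.minInterference :=
  mul_pos (mul_pos (lt_min net.mainA_pos net.sideA_pos) (lt_min net.mainU_pos net.sideU_pos))
    (Real.rpow_pos_of_pos net.RB_pos _)

theorem coverageRadius_nonneg {τ : ℝ} (hτ : 0 ≤ τ) : 0 ≤ net.coverageRadius τ :=
  Real.rpow_nonneg (div_nonneg (mul_nonneg hτ net.minInterference_pos.le)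
    (mul_pos net.mainA_pos net.mainU_pos).le) _

theorem measurableSet_visible : MeasurableSet net.visible :=
  Metric.isClosed_closedBall.measurableSet.diff (measurableSet_singleton _)

theorem real_intensity_ball {ψ r : ℝ} (hψ : 0 ≤ ψ) (hr : 0 ≤ r) :
    (net.intensity ψ).real (Metric.ball 0 r) = ψ * (r / net.RB) ^ 2 := by
  have hR := net.RB_pos
  have hlam : 0 ≤ net.lamA ψ := by unfold lamA; positivity
  rw [measureReal_ennreal_smul_apply, ENNReal.toReal_ofReal hlam, measureReal_def,
    EuclideanSpace.volume_ball_fin_two, ENNReal.toReal_mul, ENNReal.toReal_pow,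
    ENNReal.toReal_ofReal hr, ENNReal.toReal_ofReal Real.pi_pos.le, lamA]
  field_simp

theorem intensity_visible_eq (ψ : ℝ) :
    net.intensity ψ net.visible = net.intensity ψ (Metric.ball 0 net.RB) := by
  rw [visible, measure_sdiff_null (by simp), Measure.smul_apply, Measure.smul_apply,
    Measure.addHaar_closedBall_eq_addHaar_ball]

theorem real_intensity_visible {ψ : ℝ} (hψ : 0 ≤ ψ) : (net.intensity ψ).real net.visible = ψ := by
  rw [measureReal_def, intensity_visible_eq, ← measureReal_def,
    net.real_intensity_ball hψ net.RB_pos.le, div_self net.RB_pos.ne', one_pow, mul_one]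

theorem intensity_ball_ne_top (ψ r : ℝ) : net.intensity ψ (Metric.ball 0 r) ≠ ∞ :=
  ENNReal.mul_ne_top ENNReal.ofReal_ne_top measure_ball_lt_top.ne

theorem intensity_visible_ne_top (ψ : ℝ) : net.intensity ψ net.visible ≠ ∞ := by
  rw [intensity_visible_eq]
  exact net.intensity_ball_ne_top ψ _

end Params

namespace Deployment

variable {Ω : Type*} {N : Deployment Ω} {net : Params} {ω : Ω}

section Sinr

theorem server_eq_of_forall_notMem_visible {i : ℕ} (hi : N.pos i ω ∈ net.visible)
    (h : ∀ j ≠ i, N.pos j ω ∉ net.visible) : N.server net ω = i := by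
  have hzero : ∀ j ≠ i, net.invPathLoss ‖N.pos j ω‖ = 0 := fun j hj =>
    Params.invPathLoss_of_notMem_visible (h j hj)
  have hpos := Params.invPathLoss_pos_of_mem_visible hi
  have hargmax : {l : ℕ | ∀ j, net.invPathLoss ‖N.pos j ω‖ ≤ net.invPathLoss ‖N.pos l ω‖} =
      {i} := by
    refine Set.eq_singleton_iff_unique_mem.2 ⟨fun j => ?_, fun l hl => ?_⟩
    · rcases eq_or_ne j i with rfl | hj
      · exact le_rfl
      · exact (hzero j hj).trans_le hpos.le
    · by_contra hne
      exact ((hl i).trans_eq (hzero l hne)).not_gt hpos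
  rw [server, hargmax, csInf_singleton]

theorem interference_eq_zero (h : ∀ j ≠ N.server net ω, N.pos j ω ∉ net.visible) :
    N.interference net ω = 0 := by
  refine ENNReal.tsum_eq_zero.2 fun j => ?_
  split_ifs with hj
  · rfl
  · rw [Params.invPathLoss_of_notMem_visible (h j hj), mul_zero, ENNReal.ofReal_zero]

theorem signal_ne_zero (h : N.pos (N.server net ω) ω ∈ net.visible) : N.signal net ω ≠ 0 :=
  (ENNReal.ofReal_pos.2 <| mul_pos (mul_pos net.mainA_pos net.mainU_pos)
    (Params.invPathLoss_pos_of_mem_visible h)).ne'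

theorem sinr_eq_top_of_pointCount_visible_eq_one (h : pointCount N.pos net.visible ω = 1) :
    N.sinr net ω = ∞ := by
  obtain ⟨i, hi⟩ := Set.encard_eq_one.1 h
  have hmem : ∀ j, N.pos j ω ∈ net.visible ↔ j = i := fun j => Set.ext_iff.1 hi j
  have hserver : N.server net ω = i := server_eq_of_forall_notMem_visible ((hmem i).2 rfl)
    fun j hj => mt (hmem j).1 hj
  rw [sinr, interference_eq_zero fun j hj => mt (hmem j).1 (hserver ▸ hj)]
  exact ENNReal.div_zero (signal_ne_zero ((hmem _).2 hserver))

theorem minInterference_le_interference {j : ℕ} (hj : N.pos j ω ∈ net.visible)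
    (hne : j ≠ N.server net ω) (hA : min net.mainA net.sideA ≤ N.gainA j ω)
    (hU : min net.mainU net.sideU ≤ N.gainU j ω) :
    ENNReal.ofReal net.minInterference ≤ N.interference net ω := by
  refine le_trans ?_ (ENNReal.le_tsum j)
  rw [if_neg hne, Params.minInterference]
  have hgainA : 0 ≤ N.gainA j ω := (le_min net.mainA_pos.le net.sideA_pos.le).trans hA
  have hminU : 0 ≤ min net.mainU net.sideU := le_min net.mainU_pos.le net.sideU_pos.le
  have hgainU : 0 ≤ N.gainU j ω := hminU.trans hU
  have hRB := net.RB_pos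
  gcongr
  exact Params.rpow_neg_alpha_le_invPathLoss_of_mem_visible hj

theorem norm_server_lt_coverageRadius {τ : ℝ} (hτ : 0 < τ)
    (hint : ENNReal.ofReal net.minInterference ≤ N.interference net ω)
    (h : ENNReal.ofReal τ < N.sinr net ω) :
    ‖N.pos (N.server net ω) ω‖ < net.coverageRadius τ := by
  have hm := net.minInterference_pos
  have hG := mul_pos net.mainA_pos net.mainU_pos
  have hlt : ENNReal.ofReal (τ * net.minInterference) < N.signal net ω := by
    rw [ENNReal.ofReal_mul hτ.le]
    exact ENNReal.mul_lt_of_lt_div (h.trans_le (ENNReal.div_le_div_left hint _))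
  rw [signal, ENNReal.ofReal_lt_ofReal_iff_of_nonneg (mul_pos hτ hm).le] at hlt
  exact Params.norm_lt_rpow_of_lt_invPathLoss (div_pos (mul_pos hτ hm) hG)
    ((div_lt_iff₀' hG).2 hlt)

theorem pointCount_visible_le_one_or_pointCount_ball_ne_zero {τ : ℝ} (hτ : 0 < τ)
    (hA : ∀ i, min net.mainA net.sideA ≤ N.gainA i ω)
    (hU : ∀ i, min net.mainU net.sideU ≤ N.gainU i ω) (h : ENNReal.ofReal τ < N.sinr net ω) :
    pointCount N.pos net.visible ω ≤ 1 ∨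
      pointCount N.pos (Metric.ball 0 (net.coverageRadius τ)) ω ≠ 0 := by
  refine or_iff_not_imp_left.2 fun hcount => ?_
  obtain ⟨j, hj, hne⟩ :=
    (Set.one_lt_encard_iff_nontrivial.1 (not_le.1 hcount)).exists_ne (N.server net ω)
  have hserver := norm_server_lt_coverageRadius hτ
    (minInterference_le_interference hj hne (hA j) (hU j)) h
  exact Set.encard_ne_zero.2 ⟨N.server net ω, mem_ball_zero_iff.2 hserver⟩

end Sinr

section Coverage

variable [MeasurableSpace Ω] {P : Measure Ω} {ψ : ℝ} {k : ℕ}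

theorem coverage_nonneg (τ : ℝ) : 0 ≤ N.coverage net P τ := measureReal_nonneg

variable [IsProbabilityMeasure P]

theorem coverage_le_one (τ : ℝ) : N.coverage net P τ ≤ 1 := measureReal_le_one

theorem coverage_antitone : Antitone (N.coverage net P) := fun _ _ h =>
  measureReal_mono fun _ hω => (ENNReal.ofReal_le_ofReal h).trans_lt hω

theorem IsNetwork.coverage_pos (h : N.IsNetwork net ψ k P) (hψ : 0 < ψ) (τ : ℝ) :
    0 < N.coverage net P τ := by
  have hsingle : 0 < P.real {ω | pointCount N.pos net.visible ω = (1 : ℕ)} := by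
    rw [h.poisson.measureReal_pointCount_eq net.measurableSet_visible
      (net.intensity_visible_ne_top ψ), net.real_intensity_visible hψ.le]
    positivity
  refine hsingle.trans_le (measureReal_mono fun ω hω => ?_)
  have hsinr : N.sinr net ω = ∞ := sinr_eq_top_of_pointCount_visible_eq_one (by simpa using hω)
  exact ENNReal.ofReal_lt_top.trans_eq hsinr.symm

theorem IsNetwork.coverage_le (h : N.IsNetwork net ψ k P) (hψ : 0 ≤ ψ) {τ : ℝ} (hτ : 0 < τ) :
    N.coverage net P τ ≤
      (1 + ψ) * Real.exp (-ψ) + ψ * (net.coverageRadius τ / net.RB) ^ 2 := by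
  have hfew : P.real {ω | pointCount N.pos net.visible ω ≤ 1} = (1 + ψ) * Real.exp (-ψ) := by
    rw [h.poisson.measureReal_pointCount_le_one net.measurableSet_visible
      (net.intensity_visible_ne_top ψ), net.real_intensity_visible hψ]
  have hnear : P.real {ω | pointCount N.pos (Metric.ball 0 (net.coverageRadius τ)) ω ≠ 0} ≤
      ψ * (net.coverageRadius τ / net.RB) ^ 2 := by
    rw [h.poisson.measureReal_pointCount_ne_zero measurableSet_ball
      (net.intensity_ball_ne_top ψ _), net.real_intensity_ball hψ (net.coverageRadius_nonneg hτ.le)]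
    exact sub_le_comm.1 (Real.one_sub_le_exp_neg _)
  have hA := ae_all_iff.2 fun i =>
    ae_min_le_of_map_eq_twoPointLaw (h.measurable_gainA i).aemeasurable (h.law_gainA i)
  have hU := ae_all_iff.2 fun i =>
    ae_min_le_of_map_eq_twoPointLaw (h.measurable_gainU i).aemeasurable (h.law_gainU i)
  refine le_trans ?_ ((measureReal_union_le _ _).trans (add_le_add hfew.le hnear))
  refine ENNReal.toReal_mono (measure_ne_top _ _) (measure_mono_ae ?_)
  filter_upwards [hA, hU] with ω hA hU hω
  exact pointCount_visible_le_one_or_pointCount_ball_ne_zero hτ hA hU hω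

end Coverage

end Deployment

/-- `p` is a probability mass function on the positive integers, as is the law of the number `Ψ` of
end-users that share an access point. -/
structure IsLoadLaw (p : ℕ → ℝ) : Prop where
  nonneg : ∀ n, 0 ≤ p n
  zero : p 0 = 0
  hasSum_one : HasSum p 1

theorem IsLoadLaw.exists_pos {p : ℕ → ℝ} (hp : IsLoadLaw p) : ∃ n, 0 < p n := by
  by_contra! hle
  have hp0 : p = 0 := funext fun n => (hle n).antisymm (hp.nonneg n)
  exact zero_ne_one (hasSum_zero.unique (hp0 ▸ hp.hasSum_one))

namespace Deployment

section Throughput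

variable {Ω : Type*} [MeasurableSpace Ω] {N : Deployment Ω} {net : Params} {P : Measure Ω}
  {p : ℕ → ℝ} {ρ : ℝ}

theorem throughput_nonneg (hp : IsLoadLaw p) (hρ : 0 ≤ ρ) : 0 ≤ N.throughput net P p ρ :=
  mul_nonneg (mul_nonneg net.lamU_pos.le hρ) <|
    tsum_nonneg fun n => mul_nonneg (hp.nonneg n) (coverage_nonneg _)

variable [IsProbabilityMeasure P]

theorem summable_mul_coverage (hp : IsLoadLaw p) (τ : ℕ → ℝ) :
    Summable fun n => p n * N.coverage net P (τ n) :=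
  hp.hasSum_one.summable.of_nonneg_of_le (fun n => mul_nonneg (hp.nonneg n) (coverage_nonneg _))
    fun n => mul_le_of_le_one_right (hp.nonneg n) (coverage_le_one _)

theorem IsNetwork.throughput_pos {ψ : ℝ} {k : ℕ} (h : N.IsNetwork net ψ k P) (hψ : 0 < ψ)
    (hp : IsLoadLaw p) (hρ : 0 < ρ) : 0 < N.throughput net P p ρ := by
  obtain ⟨n, hn⟩ := hp.exists_pos
  exact mul_pos (mul_pos net.lamU_pos hρ) <| (summable_mul_coverage hp _).tsum_pos
    (fun m => mul_nonneg (hp.nonneg m) (coverage_nonneg _)) n (mul_pos hn (h.coverage_pos hψ _))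

theorem throughput_le (hp : IsLoadLaw p) (hρ : 0 ≤ ρ) :
    N.throughput net P p ρ ≤
      net.lamU * ρ * N.coverage net P ((2 : ℝ) ^ (ρ / net.B) - 1) := by
  have hB := net.B_pos
  refine mul_le_mul_of_nonneg_left ?_ (mul_nonneg net.lamU_pos.le hρ)
  refine hasSum_le (fun n => ?_) (summable_mul_coverage hp _).hasSum
    (by simpa only [one_mul] using
      hp.hasSum_one.mul_right (N.coverage net P ((2 : ℝ) ^ (ρ / net.B) - 1)))
  rcases n.eq_zero_or_pos with rfl | hn
  · simp only [hp.zero, zero_mul, le_refl]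
  · refine mul_le_mul_of_nonneg_left (coverage_antitone ?_) (hp.nonneg n)
    have hle : ρ ≤ ρ * n := le_mul_of_one_le_right hρ (Nat.one_le_cast.2 hn)
    gcongr
    exact one_le_two

end Throughput

end Deployment

section Asymptotics

theorem tendsto_mul_rpow_sub_one_rpow_neg {β a b : ℝ} (hβ : 1 < β) (ha : 0 < a) (hb : 0 < b) :
    Tendsto (fun x : ℝ => x * (β ^ (a * x) - 1) ^ (-b)) atTop (nhds 0) := by
  have hβ0 : 0 < β := one_pos.trans hβ
  set c := Real.log β * a with hc
  have hc0 : 0 < c := mul_pos (Real.log_pos hβ) ha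
  have hexp : Tendsto (fun x : ℝ => x * Real.exp (-(c * b) * x)) atTop (nhds 0) := by
    simpa using tendsto_rpow_mul_exp_neg_mul_atTop_nhds_zero 1 (c * b) (by positivity)
  have hcorr : Tendsto (fun x : ℝ => (1 - Real.exp (-(c * x))) ^ (-b)) atTop (nhds 1) := by
    have hdecay : Tendsto (fun x : ℝ => Real.exp (-(c * x))) atTop (nhds 0) :=
      Real.tendsto_exp_neg_atTop_nhds_zero.comp (tendsto_id.const_mul_atTop hc0)
    simpa using (hdecay.const_sub 1).rpow_const (p := -b) (by norm_num)
  have hprod := hexp.mul hcorr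
  rw [zero_mul] at hprod
  refine hprod.congr' ?_
  filter_upwards [eventually_ge_atTop 0] with x hx
  have hle : Real.exp (-(c * x)) ≤ 1 := Real.exp_le_one_iff.2 (by nlinarith)
  calc x * Real.exp (-(c * b) * x) * (1 - Real.exp (-(c * x))) ^ (-b)
      = x * (Real.exp (c * x) * (1 - Real.exp (-(c * x)))) ^ (-b) := by
        rw [Real.mul_rpow (Real.exp_pos _).le (sub_nonneg.2 hle), ← Real.exp_mul]
        ring_nf
    _ = x * (β ^ (a * x) - 1) ^ (-b) := by
        rw [mul_sub, mul_one, ← Real.exp_add, add_neg_cancel, Real.exp_zero,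
          Real.rpow_def_of_pos hβ0, hc, mul_assoc]

theorem Params.tendsto_mul_coverageRadius (net : Params) {ρ₀ : ℝ} (hρ₀ : 0 < ρ₀) :
    Tendsto (fun ψ : ℝ => ψ * net.coverageRadius ((2 : ℝ) ^ (ψ * ρ₀ / net.B) - 1)) atTop
      (nhds 0) := by
  have hB := net.B_pos
  set q := net.minInterference / (net.mainA * net.mainU) with hq
  have hq0 : 0 ≤ q :=
    div_nonneg net.minInterference_pos.le (mul_pos net.mainA_pos net.mainU_pos).le
  have hlim := (tendsto_mul_rpow_sub_one_rpow_neg one_lt_two (div_pos hρ₀ hB)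
    (inv_pos.2 net.alpha_pos)).mul_const (q ^ (-net.alpha)⁻¹)
  rw [zero_mul] at hlim
  refine hlim.congr' ?_
  filter_upwards [eventually_ge_atTop 0] with ψ hψ
  have hτ : 0 ≤ (2 : ℝ) ^ (ψ * ρ₀ / net.B) - 1 :=
    sub_nonneg.2 (Real.one_le_rpow one_le_two (by positivity))
  rw [coverageRadius, mul_div_assoc, ← hq, Real.mul_rpow hτ hq0, inv_neg, mul_assoc,
    div_mul_eq_mul_div, mul_comm ρ₀]

variable {net : Params} {ρ₀ : ℝ} {Ω : ℝ → Type*} [∀ ψ, MeasurableSpace (Ω ψ)]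
  {P : ∀ ψ, Measure (Ω ψ)} [∀ ψ, IsProbabilityMeasure (P ψ)] {N : ∀ ψ, Deployment (Ω ψ)} {k : ℕ}

theorem tendsto_mul_coverage (hρ₀ : 0 < ρ₀)
    (hN : ∀ ψ, 0 < ψ → (N ψ).IsNetwork net ψ k (P ψ)) :
    Tendsto (fun ψ => ψ * (N ψ).coverage net (P ψ) ((2 : ℝ) ^ (ψ * ρ₀ / net.B) - 1)) atTop
      (nhds 0) := by
  have hB := net.B_pos
  have hfew := (Real.tendsto_pow_mul_exp_neg_atTop_nhds_zero 1).add
    (Real.tendsto_pow_mul_exp_neg_atTop_nhds_zero 2)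
  have hnear := ((net.tendsto_mul_coverageRadius hρ₀).div_const net.RB).pow 2
  have hbound := hfew.add hnear
  rw [zero_div, zero_pow two_ne_zero, add_zero, add_zero] at hbound
  refine squeeze_zero' ?_ ?_ hbound
  · filter_upwards [eventually_ge_atTop 0] with ψ hψ
    exact mul_nonneg hψ (Deployment.coverage_nonneg _)
  · filter_upwards [eventually_gt_atTop 0] with ψ hψ
    have hτ : 0 < (2 : ℝ) ^ (ψ * ρ₀ / net.B) - 1 :=
      sub_pos.2 (Real.one_lt_rpow one_lt_two (by positivity))
    refine (mul_le_mul_of_nonneg_left ((hN ψ hψ).coverage_le hψ.le hτ) hψ.le).trans_eq ?_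
    ring

theorem tendsto_throughput_mul (hρ₀ : 0 < ρ₀)
    (hN : ∀ ψ, 0 < ψ → (N ψ).IsNetwork net ψ k (P ψ)) {p : ℝ → ℕ → ℝ}
    (hp : ∀ ψ, 0 < ψ → IsLoadLaw (p ψ)) :
    Tendsto (fun ψ => (N ψ).throughput net (P ψ) (p ψ) (ψ * ρ₀)) atTop (nhds 0) := by
  have hbound := (tendsto_mul_coverage hρ₀ hN).const_mul (net.lamU * ρ₀)
  rw [mul_zero] at hbound
  refine squeeze_zero' ?_ ?_ hbound
  · filter_upwards [eventually_gt_atTop 0] with ψ hψ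
    exact Deployment.throughput_nonneg (hp ψ hψ) (mul_pos hψ hρ₀).le
  · filter_upwards [eventually_gt_atTop 0] with ψ hψ
    refine (Deployment.throughput_le (hp ψ hψ) (mul_pos hψ hρ₀).le).trans_eq ?_
    ring

end Asymptotics

section MixedPoisson

/-- The law of `Ψ` when, given `y`, `Ψ - 1` is Poisson with mean `lam * y`, and `y` has density
proportional to `f` with respect to `μ`. -/
noncomputable def shiftedMixedPoissonPMF (μ : Measure ℝ) (f : ℝ → ℝ) (lam : ℝ) (n : ℕ) : ℝ :=
  if n = 0 then 0 else
    (∫ y, Real.exp (-(lam * y)) * (lam * y) ^ (n - 1) / ((n - 1)! : ℝ) * f y ∂μ) / ∫ y, f y ∂μ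

theorem hasSum_integral_poisson_mul {α : Type*} [MeasurableSpace α] {μ : Measure α} {m f : α → ℝ}
    (hm : AEMeasurable m μ) (hm0 : 0 ≤ᵐ[μ] m) (hf : Integrable f μ) :
    HasSum (fun n : ℕ => ∫ a, Real.exp (-m a) * m a ^ n / (n ! : ℝ) * f a ∂μ) (∫ a, f a ∂μ) := by
  have hpoisson : ∀ᵐ a ∂μ, ∀ x : ℝ,
      HasSum (fun n : ℕ => Real.exp (-m a) * m a ^ n / (n ! : ℝ) * x) x := by
    filter_upwards [hm0] with a ha x
    simpa only [Real.coe_toNNReal _ ha, one_mul] using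
      (hasSum_one_poissonMeasure (m a).toNNReal).mul_right x
  refine hasSum_integral_of_dominated_convergence
    (fun n a => Real.exp (-m a) * m a ^ n / (n ! : ℝ) * ‖f a‖) (fun n => ?_) (fun n => ?_) ?_ ?_ ?_
  · exact (AEMeasurable.aestronglyMeasurable (by fun_prop)).mul hf.aestronglyMeasurable
  · filter_upwards [hm0] with a ha
    have hma : 0 ≤ m a := ha
    rw [norm_mul, Real.norm_of_nonneg (by positivity)]
  · filter_upwards [hpoisson] with a ha using (ha _).summable
  · refine hf.norm.congr ?_
    filter_upwards [hpoisson] with a ha using (ha _).tsum_eq.symm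
  · filter_upwards [hpoisson] with a ha using ha _

theorem isLoadLaw_shiftedMixedPoissonPMF {μ : Measure ℝ} {f : ℝ → ℝ} {lam : ℝ} (hlam : 0 ≤ lam)
    (hμ : ∀ᵐ y ∂μ, 0 ≤ y) (hf0 : 0 ≤ᵐ[μ] f) (hf : ∫ y, f y ∂μ ≠ 0) :
    IsLoadLaw (shiftedMixedPoissonPMF μ f lam) where
  nonneg n := by
    rw [shiftedMixedPoissonPMF]
    split_ifs with hn
    · rfl
    · refine div_nonneg (integral_nonneg_of_ae ?_) (integral_nonneg_of_ae hf0)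
      filter_upwards [hμ, hf0] with y hy hfy
      have hfy' : 0 ≤ f y := hfy
      positivity
  zero := if_pos rfl
  hasSum_one := by
    have hsum := (hasSum_integral_poisson_mul (m := fun y => lam * y) (by fun_prop)
      (hμ.mono fun y hy => mul_nonneg hlam hy)
      (Integrable.of_integral_ne_zero hf)).div_const (∫ y, f y ∂μ)
    rw [div_self hf] at hsum
    refine (hasSum_nat_add_iff' 1).1 ?_
    simpa [shiftedMixedPoissonPMF] using hsum

theorem integral_poisson_mul_rpow_mul_exp {lam a c : ℝ} (hlam : 0 ≤ lam) (ha : 0 < a)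
    (hc : 0 < c) (n : ℕ) :
    ∫ y in Set.Ioi (0 : ℝ), Real.exp (-(lam * y)) * (lam * y) ^ n / (n ! : ℝ) *
        (y ^ (a - 1) * Real.exp (-(c * y))) =
      lam ^ n / (n ! : ℝ) * ((1 / (lam + c)) ^ (n + a) * Real.Gamma (n + a)) := by
  rw [← Real.integral_rpow_mul_exp_neg_mul_Ioi (by positivity) (by positivity),
    ← integral_const_mul]
  refine setIntegral_congr_fun measurableSet_Ioi fun y hy => ?_
  have hrpow : y ^ ((n : ℝ) + a - 1) = y ^ n * y ^ (a - 1) := by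
    rw [add_sub_assoc, Real.rpow_add hy, Real.rpow_natCast]
  have hexp : Real.exp (-((lam + c) * y)) = Real.exp (-(lam * y)) * Real.exp (-(c * y)) := by
    rw [← Real.exp_add]
    ring_nf
  simp only [hrpow, hexp]
  ring

theorem integral_poisson_mul_gamma_div_integral_gamma {lam a b c : ℝ} (hlam : 0 ≤ lam)
    (ha : 0 < a) (hb : 0 < b) (hc : 0 < c) (n : ℕ) :
    (∫ y in Set.Ioi (0 : ℝ), Real.exp (-(lam * y)) * (lam * y) ^ n / (n ! : ℝ) *
        (y ^ (a - 1) * Real.exp (-(b * c * y)))) /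
      ∫ y in Set.Ioi (0 : ℝ), y ^ (a - 1) * Real.exp (-(b * c * y)) =
      b ^ a * Real.Gamma (n + a) / ((n ! : ℝ) * Real.Gamma a) * (lam / c) ^ n *
        (b + lam / c) ^ (-((n : ℝ) + a)) := by
  have hbc : 0 < b * c := mul_pos hb hc
  have hGamma := (Real.Gamma_pos_of_pos ha).ne'
  have hnum : (1 / (lam + b * c)) ^ ((n : ℝ) + a) =
      (b + lam / c) ^ (-((n : ℝ) + a)) * (c ^ n * c ^ a)⁻¹ := by
    have hfactor : lam + b * c = (b + lam / c) * c := by field_simp; ring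
    rw [hfactor, one_div, Real.inv_rpow (by positivity),
      Real.mul_rpow (by positivity) hc.le, Real.rpow_add hc, Real.rpow_natCast, mul_inv,
      ← Real.rpow_neg (by positivity)]
  rw [integral_poisson_mul_rpow_mul_exp hlam ha hbc,
    Real.integral_rpow_mul_exp_neg_mul_Ioi ha hbc, hnum, one_div, Real.inv_rpow hbc.le,
    Real.mul_rpow hb.le hc.le, div_pow]
  field_simp [hGamma]

end MixedPoisson

section Load

variable {net : Params} {ψ : ℝ} {k : ℕ}

namespace Params

theorem lamA_pos (hψ : 0 < ψ) : 0 < net.lamA ψ :=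
  div_pos hψ (mul_pos Real.pi_pos (pow_pos net.RB_pos 2))

theorem areaDensity_pos {y : ℝ} (hy : 0 < y) : 0 < net.areaDensity ψ k y :=
  mul_pos (Real.rpow_pos_of_pos hy _) (Real.exp_pos _)

theorem continuous_areaDensity : Continuous (net.areaDensity ψ k) :=
  (Real.continuous_rpow_const (by norm_num)).mul (by fun_prop)

theorem areaDensity_eq (y : ℝ) :
    net.areaDensity ψ k y =
      y ^ (4.5 - 1 : ℝ) * Real.exp (-(3.5 * (k * net.lamA ψ) * y)) := by
  rw [areaDensity]
  congr 2
  · norm_num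
  · ring

theorem integral_areaDensity_Ioi (hk : 0 < k) (hψ : 0 < ψ) :
    ∫ y in Set.Ioi 0, net.areaDensity ψ k y =
      (1 / (3.5 * (k * net.lamA ψ))) ^ (4.5 : ℝ) * Real.Gamma 4.5 := by
  have hlam := net.lamA_pos hψ
  simp only [areaDensity_eq]
  exact Real.integral_rpow_mul_exp_neg_mul_Ioi (by norm_num) (by positivity)

end Params

theorem loadPMF_eq_shiftedMixedPoissonPMF :
    loadPMF net ψ k = shiftedMixedPoissonPMF
      (volume.restrict (Set.Ioc 0 (Real.pi * net.RB ^ 2 / k))) (net.areaDensity ψ k) net.lamU := by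
  have hle : 0 ≤ Real.pi * net.RB ^ 2 / k := by positivity
  ext n
  simp only [loadPMF, shiftedMixedPoissonPMF, intervalIntegral.integral_of_le hle]

theorem isLoadLaw_loadPMF (hk : 0 < k) : IsLoadLaw (loadPMF net ψ k) := by
  have hRB := net.RB_pos
  have hlt : 0 < Real.pi * net.RB ^ 2 / k := by positivity
  rw [loadPMF_eq_shiftedMixedPoissonPMF]
  refine isLoadLaw_shiftedMixedPoissonPMF net.lamU_pos.le ?_ ?_ ?_
  · exact (ae_restrict_mem measurableSet_Ioc).mono fun y hy => hy.1.le
  · exact (ae_restrict_mem measurableSet_Ioc).mono fun y hy => (Params.areaDensity_pos hy.1).le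
  · rw [← intervalIntegral.integral_of_le hlt.le]
    exact (intervalIntegral.intervalIntegral_pos_of_pos_on
      (Params.continuous_areaDensity.intervalIntegrable _ _)
      (fun y hy => Params.areaDensity_pos hy.1) hlt).ne'

theorem simplifiedLoadPMF_eq_shiftedMixedPoissonPMF (hk : 0 < k) (hψ : 0 < ψ) :
    simplifiedLoadPMF net ψ k = shiftedMixedPoissonPMF
      (volume.restrict (Set.Ioi 0)) (net.areaDensity ψ k) net.lamU := by
  ext n
  rcases n with _ | n
  · simp only [simplifiedLoadPMF, shiftedMixedPoissonPMF, if_true]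
  have hRB := net.RB_pos
  have hc : 0 < k * net.lamA ψ := mul_pos (Nat.cast_pos.2 hk) (net.lamA_pos hψ)
  have hratio : Real.pi * net.RB ^ 2 * net.lamU / (k * ψ) = net.lamU / (k * net.lamA ψ) := by
    rw [Params.lamA]
    field_simp
  have hshift : ((n + 1 : ℕ) : ℝ) + 3.5 = n + 4.5 := by
    push_cast
    ring
  have hGamma : Real.Gamma 4.5 = 3.5 * Real.Gamma 3.5 := by
    rw [← Real.Gamma_add_one (by norm_num)]
    norm_num
  have hpow : (3.5 : ℝ) ^ (4.5 : ℝ) = 3.5 * (3.5 : ℝ) ^ (3.5 : ℝ) := by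
    rw [← Real.rpow_one_add' (by norm_num) (by norm_num)]
    norm_num
  simp only [simplifiedLoadPMF, shiftedMixedPoissonPMF, if_neg n.succ_ne_zero, Nat.add_sub_cancel,
    Params.areaDensity_eq]
  rw [integral_poisson_mul_gamma_div_integral_gamma net.lamU_pos.le (by norm_num) (by norm_num) hc,
    hratio, ← neg_add', hshift, hGamma, hpow]
  field_simp

theorem isLoadLaw_simplifiedLoadPMF (hk : 0 < k) (hψ : 0 < ψ) :
    IsLoadLaw (simplifiedLoadPMF net ψ k) := by
  have hlam := net.lamA_pos hψ
  rw [simplifiedLoadPMF_eq_shiftedMixedPoissonPMF hk hψ]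
  refine isLoadLaw_shiftedMixedPoissonPMF net.lamU_pos.le ?_ ?_ ?_
  · exact (ae_restrict_mem measurableSet_Ioi).mono fun y hy => le_of_lt hy
  · exact (ae_restrict_mem measurableSet_Ioi).mono fun y hy => (Params.areaDensity_pos hy).le
  · rw [Params.integral_areaDensity_Ioi hk hψ]
    exact (mul_pos (Real.rpow_pos_of_pos (by positivity) _)
      (Real.Gamma_pos_of_pos (by norm_num))).ne'

end Load

end MmWave

open MmWave in
theorem lemma3_general (net : Params) {ρ₀ : ℝ} (hρ₀ : 0 < ρ₀)
    {Ω : ℝ → Type*} [∀ ψ, MeasurableSpace (Ω ψ)]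
    (P : ∀ ψ, Measure (Ω ψ)) [∀ ψ, IsProbabilityMeasure (P ψ)]
    (N : ∀ ψ, Deployment (Ω ψ)) {k : ℕ}
    (hN : ∀ ψ, 0 < ψ → (N ψ).IsNetwork net ψ k (P ψ))
    {load : ℝ → ℕ → ℕ → ℝ} (hload : ∀ ψ, 0 < ψ → IsLoadLaw (load ψ k)) :
    0 < (N 1).throughput net (P 1) (load 1 k) ρ₀ ∧
      Tendsto (fun ψ => densificationGain net P N load ρ₀ ψ k) atTop (nhds 0) := by
  refine ⟨(hN 1 one_pos).throughput_pos one_pos (hload 1 one_pos) hρ₀, ?_⟩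
  simpa only [densificationGain, zero_div] using
    (tendsto_throughput_mul hρ₀ hN hload).div_const _

open MmWave in
theorem lemma3 (net : Params) (ρ₀ : ℝ) (hρ₀ : 0 < ρ₀)
    {Ω : ℝ → Type*} [∀ ψ, MeasurableSpace (Ω ψ)]
    (P : ∀ ψ, Measure (Ω ψ)) [∀ ψ, IsProbabilityMeasure (P ψ)]
    (N : ∀ ψ, Deployment (Ω ψ))
    (hN : ∀ ψ, 0 < ψ → (N ψ).IsNetwork net ψ 1 (P ψ))
    (load : ℝ → ℕ → ℕ → ℝ) (hload : load = loadPMF net ∨ load = simplifiedLoadPMF net) :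
    0 < (N 1).throughput net (P 1) (load 1 1) ρ₀ ∧
      ∃ a : ℝ, ∀ᶠ ψ in atTop, densificationGain net P N load ρ₀ ψ 1 ≤ a := by
  have hlaw : ∀ ψ, 0 < ψ → IsLoadLaw (load ψ 1) := by
    rcases hload with rfl | rfl
    · exact fun ψ _ => isLoadLaw_loadPMF one_pos
    · exact fun ψ hψ => isLoadLaw_simplifiedLoadPMF one_pos hψ
  exact (lemma3_general net hρ₀ P N hN hlaw).imp_right Tendsto.isBoundedUnder_le
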